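/- Let $\mathbf A=(a_{ij})_{i,j\ge 0}$ be the infinite real matrix with entries \[ a_{00}=\tfrac12,\qquad a_{01}=-1,\qquad a_{0j}=0\ (j\ge 2), \] \[ a_{10}=\frac{\pi^2}{12}+\sum_{k=1}^\infty\frac{(-1)^k}{k^2 2^k}-\frac{\log 2}{2},\qquad a_{11}=\tfrac12+\log 2,\qquad a_{1,k+1}=\frac1k+\frac{(-1)^k}{2^{k+1}}-\frac1{k2^k}\ (k\ge 1), \] and, for $r\ge 1$, \[ a_{r+1,0}=\frac{(-1)^r}{r}\sum_{j=r}^\infty\frac1{j3^j},\qquad a_{r+1,1}=0,\qquad a_{r+1,k+1}=\binom kr\left(\frac{(-1)^{k-r}}{2^{k+1}}-\frac1{k2^k}\right)\ (k\ge 1), \] where $\binom kr=0$ for $k<r$. For $m\ge 0$ let $\mathbf A_m=(a_{ij})_{0\le i,j\le m}$ be its leading $(m+1)\times(m+1)$ principal submatrix. Then for every $m\ge 7$ the matrix $\mathbf A_m$ has exactly one real eigenvalue $\lambda_m$ in the interval $[1.232891-0.0007,\ 1.232891+0.0007]$; it is simple, that is, of algebraic multiplicity one. Every other complex eigenvalue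 $z$ of $\mathbf A_m$ satisfies $|z|<1.002$. -/

import Mathlib

open scoped BigOperators

noncomputable section

namespace CarParking

/-- `Li₂(-1/2) = ∑_{k ≥ 1} (-1)^k / (k² 2^k)`, approximately `-0.4484`. -/
def dilogNegHalf : ℝ :=
  ∑' k : ℕ, (-1 : ℝ) ^ (k + 1) / (((k : ℝ) + 1) ^ 2 * 2 ^ (k + 1))

/-- The tail `∑_{j ≥ r} 1 / (j 3^j)`, used only for `r ≥ 1`. -/
def logTail (r : ℕ) : ℝ :=
  ∑' i : ℕ, 1 / (((r + i : ℕ) : ℝ) * 3 ^ (r + i))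

/-- Entries of row `1` in column `k + 1`, for `k ≥ 1`. -/
def rowOneEntry (k : ℕ) : ℝ :=
  1 / (k : ℝ) + (-1) ^ k / 2 ^ (k + 1) - 1 / ((k : ℝ) * 2 ^ k)

/-- Entries in row `r + 1` and column `k + 1`, for `r, k ≥ 1`. They vanish for `k < r`
because the binomial coefficient does; as `(-1)^(k-r) = (-1)^(k+r)`, the exponent is
written without subtraction. -/
def blockEntry (r k : ℕ) : ℝ :=
  (k.choose r : ℝ) * ((-1) ^ (k + r) / 2 ^ (k + 1) - 1 / ((k : ℝ) * 2 ^ k))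

/-- The infinite matrix acting on the coefficients `(ℓ, a₀, a₁, a₂, …)` of
`ℓ log t + ∑ a_k (t - 1)^k`. Index `0` belongs to `ℓ`, index `k + 1` to `a_k`. -/
def A : Matrix ℕ ℕ ℝ := Matrix.of fun i j =>
  match i, j with
  | 0, 0 => 1 / 2
  | 0, 1 => -1
  | 0, _ + 2 => 0
  | 1, 0 => Real.pi ^ 2 / 12 + dilogNegHalf - Real.log 2 / 2
  | 1, 1 => 1 / 2 + Real.log 2
  | 1, k + 2 => rowOneEntry (k + 1)
  | r + 2, 0 => (-1) ^ (r + 1) / ((r + 1 : ℕ) : ℝ) * logTail (r + 1)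
  | _ + 2, 1 => 0
  | r + 2, k + 2 => blockEntry (r + 1) (k + 1)

/-- The `(m + 1) × (m + 1)` leading principal submatrix of `A`. -/
def truncA (m : ℕ) : Matrix (Fin (m + 1)) (Fin (m + 1)) ℝ :=
  A.submatrix (fun i => (i : ℕ)) (fun j => (j : ℕ))

/-- `truncA m` with its entries regarded as complex numbers. -/
def truncAC (m : ℕ) : Matrix (Fin (m + 1)) (Fin (m + 1)) ℂ :=
  (truncA m).map (fun x : ℝ => (x : ℂ))

end CarParking

end

noncomputable section

namespace CarParking

/-! ### Entries of the first column -/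

/-! Work with left eigenvectors `x`. Beyond the first two indices the matrix has an upper triangular
block `B` whose columns have absolute sums at most 1/2, so for `|z| > 1/2` the tail of `x` is
determined by `x 1` (`norm_mul_le_of_block_eq`). Column 1 then determines `x 0`, so one may
normalise `x 1 = 1`, and column 0 leaves a single scalar equation.

Existence: for real `t > 1/2` that equation is `schur n t = 0`, with `schur n` continuous. All but
four terms of its sum are negligible, so a sign change of `schurHead` gives a root for every `n ≥
4`.

Uniqueness, simplicity and the bound on the other eigenvalues come from one estimate,
`norm_lt_of_chain`. A second eigenvalue `z` yields a difference quotient `y` of normalised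
eigenvectors with `y A = z y + x` and `y 1 = 0`; a Jordan chain at `lam` yields the same equation
with `z = lam`. Column 0 then expresses `z` as `1 + log 2 - lam` plus a small sum, which forces `|z|
< 1.002`. -/

theorem logTail_term_le (r : ℕ) (hr : 1 ≤ r) (i : ℕ) :
    1 / (((r + i : ℕ) : ℝ) * 3 ^ (r + i)) ≤ 1 / ((r : ℝ) * 3 ^ r) * (1 / 3) ^ i := by
  have h1 : (1 : ℝ) ≤ r := by exact_mod_cast hr
  rw [one_div_pow, div_mul_div_comm, one_mul, pow_add, mul_assoc]
  gcongr
  exact_mod_cast Nat.le_add_right r i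

theorem hasSum_logTail_majorant (r : ℕ) :
    HasSum (fun i : ℕ => 1 / ((r : ℝ) * 3 ^ r) * (1 / 3) ^ i) (3 / (2 * r * 3 ^ r)) := by
  have h := (hasSum_geometric_of_lt_one (r := (1 / 3 : ℝ)) (by norm_num) (by norm_num)).mul_left
    (1 / ((r : ℝ) * 3 ^ r))
  rwa [show 1 / ((r : ℝ) * 3 ^ r) * (1 - 1 / 3)⁻¹ = 3 / (2 * r * 3 ^ r) by
    rw [show (1 - 1 / 3 : ℝ)⁻¹ = 3 / 2 by norm_num, div_mul_div_comm]
    ring] at h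

theorem summable_logTail (r : ℕ) (hr : 1 ≤ r) :
    Summable fun i : ℕ => 1 / (((r + i : ℕ) : ℝ) * 3 ^ (r + i)) :=
  Summable.of_nonneg_of_le (fun _ => by positivity) (logTail_term_le r hr)
    (hasSum_logTail_majorant r).summable

theorem logTail_nonneg (r : ℕ) : 0 ≤ logTail r :=
  tsum_nonneg fun _ => by positivity

theorem logTail_le (r : ℕ) (hr : 1 ≤ r) : logTail r ≤ 3 / (2 * r * 3 ^ r) :=
  (summable_logTail r hr).tsum_le_of_sum_le fun s =>
    (Finset.sum_le_sum fun i _ => logTail_term_le r hr i).trans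
      (sum_le_hasSum s (fun _ _ => by positivity) (hasSum_logTail_majorant r))

theorem logTail_eq_add (r : ℕ) (hr : 1 ≤ r) :
    logTail r = 1 / ((r : ℝ) * 3 ^ r) + logTail (r + 1) := by
  rw [logTail, (summable_logTail r hr).tsum_eq_zero_add, logTail]
  simp only [add_zero]
  congr 1
  refine tsum_congr fun i => ?_
  rw [show r + (i + 1) = r + 1 + i by ring]

/-- The entry of `A` in row `i + 2` of the first column. -/
def logCoeff (i : ℕ) : ℝ := (-1) ^ (i + 1) / ((i + 1 : ℕ) : ℝ) * logTail (i + 1)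

theorem abs_logCoeff_le (i : ℕ) :
    |logCoeff i| ≤ 3 / (2 * ((i : ℝ) + 1) ^ 2 * 3 ^ (i + 1)) := by
  have h := logTail_le (i + 1) (by omega)
  rw [logCoeff, abs_mul, abs_div, abs_pow, abs_neg, abs_one, one_pow,
    abs_of_nonneg (logTail_nonneg _), Nat.abs_cast]
  push_cast at h ⊢
  calc 1 / ((i : ℝ) + 1) * logTail (i + 1)
      ≤ 1 / ((i : ℝ) + 1) * (3 / (2 * ((i : ℝ) + 1) * 3 ^ (i + 1))) := by gcongr
    _ = _ := by field_simp

theorem sum_abs_logCoeff_le (N n : ℕ) :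
    ∑ i ∈ Finset.range n, |logCoeff (i + N)| ≤ 9 / (4 * ((N : ℝ) + 1) ^ 2 * 3 ^ (N + 1)) := by
  have h := (hasSum_geometric_of_lt_one (r := (1 / 3 : ℝ)) (by norm_num) (by norm_num)).mul_left
    (3 / (2 * ((N : ℝ) + 1) ^ 2 * 3 ^ (N + 1)))
  have h2 := sum_le_hasSum (Finset.range n) (fun _ _ => by positivity) h
  refine (Finset.sum_le_sum fun i _ => ?_).trans (h2.trans_eq ?_)
  · refine (abs_logCoeff_le (i + N)).trans ?_
    rw [one_div_pow, div_mul_div_comm, mul_one, mul_assoc _ (3 ^ (N + 1)), ← pow_add]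
    rw [show i + N + 1 = N + 1 + i by ring]
    push_cast
    gcongr
    linarith [(i.cast_nonneg : (0 : ℝ) ≤ i)]
  · rw [show (1 - 1 / 3 : ℝ)⁻¹ = 3 / 2 by norm_num, div_mul_div_comm]
    ring

/-! ### The remaining entries -/

theorem abs_rowOneEntry_le (k : ℕ) : |rowOneEntry (k + 1)| ≤ 1 / 2 := by
  match k with
  | 0 => norm_num [rowOneEntry, abs_le]
  | 1 => norm_num [rowOneEntry, abs_le]
  | k + 2 =>
    have h1 : |(-1 : ℝ) ^ (k + 2 + 1) / 2 ^ (k + 2 + 1 + 1)| ≤ 1 / 16 := by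
      rw [abs_div, abs_pow, abs_neg, abs_one, one_pow, abs_of_pos (by positivity)]
      rw [show k + 2 + 1 + 1 = 4 + k by ring, pow_add]
      have : (1 : ℝ) ≤ 2 ^ k := one_le_pow₀ (by norm_num)
      gcongr
      linarith
    have h2 : (0 : ℝ) ≤ 1 / ((k + 2 + 1 : ℕ) * 2 ^ (k + 2 + 1)) := by positivity
    have h3 : (1 : ℝ) / ((k + 2 + 1 : ℕ) * 2 ^ (k + 2 + 1)) ≤ 1 / (k + 2 + 1 : ℕ) := by
      have : (1 : ℝ) ≤ 2 ^ (k + 2 + 1) := one_le_pow₀ (by norm_num)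
      gcongr
      push_cast
      nlinarith [(k.cast_nonneg : (0 : ℝ) ≤ k)]
    have h4 : (1 : ℝ) / (k + 2 + 1 : ℕ) ≤ 1 / 3 := by
      push_cast
      gcongr
      linarith [(k.cast_nonneg : (0 : ℝ) ≤ k)]
    rw [abs_le] at h1 ⊢
    rw [rowOneEntry]
    constructor <;> linarith [h1.1, h1.2]

/-- For `k ≥ 2` the term `1 / 2 ^ (k + 1)` dominates `1 / (k 2 ^ k)`, so the sign of the entry is
`(-1) ^ (k + r)`. -/
theorem abs_blockEntry_eq (r k : ℕ) (hk : 2 ≤ k) :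
    |blockEntry r k| =
      (k.choose r : ℝ) / 2 ^ (k + 1) - (-1) ^ (k + r) * k.choose r / (k * 2 ^ k) := by
  have h1 : (2 : ℝ) ≤ k := by exact_mod_cast hk
  have h2 : (1 : ℝ) / (k * 2 ^ k) ≤ 1 / 2 ^ (k + 1) := by
    rw [pow_succ']
    gcongr
  have h3 : (0 : ℝ) ≤ 1 / (k * 2 ^ k) := by positivity
  rw [blockEntry, abs_mul, Nat.abs_cast]
  rcases neg_one_pow_eq_or ℝ (k + r) with h | h <;> rw [h]
  · rw [abs_of_nonneg (by linarith)]
    ring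
  · rw [abs_of_nonpos (by rw [neg_div]; linarith)]
    ring

theorem blockEntry_eq_zero {r k : ℕ} (h : k < r) : blockEntry r k = 0 := by
  simp [blockEntry, Nat.choose_eq_zero_of_lt h]

/-- Once row `r = 0` is added, the binomial coefficients sum to `2 ^ (k + 1)` and their alternating
sum vanishes, so the full column sum is exactly 1/2. Column 1, where the sign rule fails, is checked
directly. -/
theorem sum_range_abs_blockEntry_le (k n : ℕ) :
    ∑ i ∈ Finset.range n, |blockEntry (i + 1) (k + 1)| ≤ 1 / 2 := by
  have hsub : ∑ i ∈ Finset.range n, |blockEntry (i + 1) (k + 1)| ≤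
      ∑ i ∈ Finset.range (k + 1), |blockEntry (i + 1) (k + 1)| := by
    refine (Finset.sum_le_sum_of_subset_of_nonneg
      (Finset.range_mono (le_max_left n (k + 1))) fun _ _ _ => abs_nonneg _).trans_eq ?_
    refine (Finset.sum_subset (Finset.range_mono (le_max_right n (k + 1))) fun i _ hi => ?_).symm
    rw [Finset.mem_range, not_lt] at hi
    rw [blockEntry_eq_zero (by omega), abs_zero]
  refine hsub.trans ?_
  rcases Nat.eq_zero_or_pos k with rfl | hk
  · norm_num [blockEntry]
  · have h := Finset.sum_range_succ' (fun i => |blockEntry i (k + 1)|) (k + 1)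
    have hfull : ∑ i ∈ Finset.range (k + 1 + 1), |blockEntry i (k + 1)| = 1 / 2 := by
      simp_rw [fun i => abs_blockEntry_eq i (k + 1) (by omega)]
      rw [Finset.sum_sub_distrib, ← Finset.sum_div, ← Finset.sum_div]
      have e1 : ∑ i ∈ Finset.range (k + 1 + 1), ((k + 1).choose i : ℝ) = 2 ^ (k + 1) := by
        exact_mod_cast Nat.sum_range_choose (k + 1)
      have e2 : ∑ i ∈ Finset.range (k + 1 + 1), (-1 : ℝ) ^ (k + 1 + i) * (k + 1).choose i = 0 := by
        have := Int.alternating_sum_range_choose_of_ne (n := k + 1) (by omega)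
        have h' : ∑ i ∈ Finset.range (k + 1 + 1), (-1 : ℝ) ^ i * (k + 1).choose i = 0 := by
          exact_mod_cast this
        simp_rw [pow_add _ (k + 1), mul_assoc]
        rw [← Finset.mul_sum, h', mul_zero]
      rw [e1, e2, pow_succ]
      field_simp
      ring
    linarith [abs_nonneg (blockEntry 0 (k + 1))]

theorem sum_abs_blockEntry_le (k n : ℕ) :
    ∑ i : Fin n, |blockEntry (i + 1) (k + 1)| ≤ 1 / 2 := by
  rw [Fin.sum_univ_eq_sum_range (fun i => |blockEntry (i + 1) (k + 1)|)]
  exact sum_range_abs_blockEntry_le k n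

theorem abs_blockEntry_self_le (k : ℕ) : |blockEntry (k + 1) (k + 1)| ≤ 1 / 2 :=
  (Finset.single_le_sum (f := fun i => |blockEntry (i + 1) (k + 1)|)
    (fun _ _ => abs_nonneg _) (Finset.self_mem_range_succ k)).trans
    (sum_range_abs_blockEntry_le k (k + 1))

/-- `z - Bᵀ` is bounded below by `‖z‖ - 1/2` in the sup norm, for the block `B` of `A`. -/
theorem norm_mul_le_of_block_eq {n : ℕ} {s g : Fin n → ℂ} {z : ℂ}
    (h : ∀ k : Fin n, z * s k = g k + ∑ i : Fin n, s i * (blockEntry (i + 1) (k + 1) : ℂ)) :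
    (‖z‖ - 1 / 2) * ‖s‖ ≤ ‖g‖ := by
  have key : ∀ k : Fin n, ‖z‖ * ‖s k‖ ≤ ‖g‖ + ‖s‖ * (1 / 2) := by
    intro k
    rw [← norm_mul, h k]
    refine (norm_add_le _ _).trans (add_le_add (norm_le_pi_norm g k) ?_)
    refine (norm_sum_le _ _).trans ?_
    refine le_trans ?_ (mul_le_mul_of_nonneg_left (sum_abs_blockEntry_le k n) (norm_nonneg s))
    rw [Finset.mul_sum]
    refine Finset.sum_le_sum fun i _ => ?_
    rw [norm_mul, Complex.norm_real, Real.norm_eq_abs]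
    exact mul_le_mul_of_nonneg_right (norm_le_pi_norm s i) (abs_nonneg _)
  have : ‖z • s‖ ≤ ‖g‖ + ‖s‖ * (1 / 2) := by
    rw [pi_norm_le_iff_of_nonneg (by positivity)]
    intro k
    rw [Pi.smul_apply, smul_eq_mul, norm_mul]
    exact key k
  rw [norm_smul] at this
  linarith

/-! ### Numerical bounds -/

theorem dilogNegHalf_mem : |dilogNegHalf + 0.448414| ≤ 0.00002 := by
  have hle : ∀ k : ℕ, ‖(-1 : ℝ) ^ (k + 1) / (((k : ℝ) + 1) ^ 2 * 2 ^ (k + 1))‖ ≤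
      1 / 2 * (1 / 2) ^ k := by
    intro k
    rw [norm_div, norm_pow, norm_neg, norm_one, one_pow, Real.norm_of_nonneg (by positivity),
      ← pow_succ', one_div_pow]
    have : (1 : ℝ) ≤ ((k : ℝ) + 1) ^ 2 := by nlinarith [(k.cast_nonneg : (0 : ℝ) ≤ k)]
    gcongr
    exact le_mul_of_one_le_left (by positivity) this
  have hgeo := hasSum_geometric_of_lt_one (r := (1 / 2 : ℝ)) (by norm_num) (by norm_num)
  have hs : Summable fun k : ℕ => (-1 : ℝ) ^ (k + 1) / (((k : ℝ) + 1) ^ 2 * 2 ^ (k + 1)) :=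
    Summable.of_norm_bounded (hgeo.mul_left (1 / 2)).summable hle
  -- After ten terms the remainder is at most `2 / (121 * 2 ^ 11)`, about 8e-6; here `121 = 11 ^ 2`
  -- is the first squared index left.
  have htail := tsum_of_norm_bounded
    (f := fun k : ℕ => (-1 : ℝ) ^ (k + 10 + 1) / ((((k + 10 : ℕ) : ℝ) + 1) ^ 2 * 2 ^ (k + 10 + 1)))
    (hgeo.mul_left (1 / (121 * 2 ^ 11))) (by
      intro k
      rw [norm_div, norm_pow, norm_neg, norm_one, one_pow, Real.norm_of_nonneg (by positivity),
        one_div_pow, div_mul_div_comm, mul_one, mul_assoc, ← pow_add,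
        show k + 10 + 1 = 11 + k by ring]
      have : (121 : ℝ) ≤ (((k + 10 : ℕ) : ℝ) + 1) ^ 2 := by
        push_cast
        nlinarith [(k.cast_nonneg : (0 : ℝ) ≤ k)]
      gcongr)
  have hsplit := hs.sum_add_tsum_nat_add 10
  rw [dilogNegHalf, ← hsplit]
  rw [Real.norm_eq_abs, abs_le] at htail
  norm_num [Finset.sum_range_succ] at htail ⊢
  rw [abs_le]
  constructor <;> linarith [htail.1, htail.2]

theorem logTail_five_bounds : 0.0008 ≤ logTail 5 ∧ logTail 5 ≤ 0.00124 := by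
  have h5 := logTail_eq_add 5 (by norm_num)
  have h6 := logTail_nonneg 6
  have h := logTail_le 5 (by norm_num)
  norm_num at h5 h
  constructor <;> linarith

end CarParking

end

noncomputable section

namespace CarParking

/-! ### Left multiplication by the truncated matrices -/

/-- The entry of `A` in row `1` of the first column. -/
def constCoeff : ℝ := Real.pi ^ 2 / 12 + dilogNegHalf - Real.log 2 / 2

section vecMul

variable {n : ℕ}

theorem vecMul_truncA_zero (v : Fin (n + 2) → ℝ) :
    (Matrix.vecMul v (truncA (n + 1))) 0 =
      v 0 * (1 / 2) + (v 1 * constCoeff + ∑ i : Fin n, v i.succ.succ * logCoeff i) := by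
  simp [Matrix.vecMul, dotProduct, Fin.sum_univ_succ, truncA, A, constCoeff, logCoeff]

theorem vecMul_truncA_one (v : Fin (n + 2) → ℝ) :
    (Matrix.vecMul v (truncA (n + 1))) 1 = -v 0 + v 1 * (1 / 2 + Real.log 2) := by
  simp [Matrix.vecMul, dotProduct, Fin.sum_univ_succ, truncA, A]

theorem vecMul_truncA_succ_succ (v : Fin (n + 2) → ℝ) (k : Fin n) :
    (Matrix.vecMul v (truncA (n + 1))) k.succ.succ =
      v 1 * rowOneEntry (k + 1) + ∑ i : Fin n, v i.succ.succ * blockEntry (i + 1) (k + 1) := by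
  simp [Matrix.vecMul, dotProduct, Fin.sum_univ_succ, truncA, A]

theorem vecMul_truncAC_zero (v : Fin (n + 2) → ℂ) :
    (Matrix.vecMul v (truncAC (n + 1))) 0 =
      v 0 * (1 / 2) + (v 1 * constCoeff + ∑ i : Fin n, v i.succ.succ * logCoeff i) := by
  simp [Matrix.vecMul, dotProduct, Fin.sum_univ_succ, truncAC, truncA, A, constCoeff, logCoeff]

theorem vecMul_truncAC_one (v : Fin (n + 2) → ℂ) :
    (Matrix.vecMul v (truncAC (n + 1))) 1 = -v 0 + v 1 * (1 / 2 + Real.log 2 : ℝ) := by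
  simp [Matrix.vecMul, dotProduct, Fin.sum_univ_succ, truncAC, truncA, A]

theorem vecMul_truncAC_succ_succ (v : Fin (n + 2) → ℂ) (k : Fin n) :
    (Matrix.vecMul v (truncAC (n + 1))) k.succ.succ =
      v 1 * rowOneEntry (k + 1) + ∑ i : Fin n, v i.succ.succ * (blockEntry (i + 1) (k + 1) : ℂ) := by
  simp [Matrix.vecMul, dotProduct, Fin.sum_univ_succ, truncAC, truncA, A]

end vecMul

/-! ### Existence of the leading eigenvalue -/

/-- The solution `w` of `w (t - B) = R`, where `R` is the tail of row `1` of `A` and `B` is the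
upper triangular block of `A`, found by forward substitution. -/
def leftSol (t : ℝ) : ℕ → ℝ
  | k => (rowOneEntry (k + 1) + ∑ r : Fin k, leftSol t r * blockEntry (r + 1) (k + 1)) /
      (t - blockEntry (k + 1) (k + 1))
termination_by k => k
decreasing_by exact r.2

theorem sub_blockEntry_self_pos {t : ℝ} (ht : 1 / 2 < t) (k : ℕ) :
    0 < t - blockEntry (k + 1) (k + 1) := by
  linarith [(abs_le.1 (abs_blockEntry_self_le k)).2]

theorem mul_leftSol {t : ℝ} (ht : 1 / 2 < t) {n k : ℕ} (hk : k < n) :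
    t * leftSol t k =
      rowOneEntry (k + 1) + ∑ i : Fin n, leftSol t i * blockEntry (i + 1) (k + 1) := by
  have hsum : ∑ i : Fin n, leftSol t i * blockEntry (i + 1) (k + 1) =
      ∑ i : Fin k, leftSol t i * blockEntry (i + 1) (k + 1) +
        leftSol t k * blockEntry (k + 1) (k + 1) := by
    rw [Fin.sum_univ_eq_sum_range (fun i => leftSol t i * blockEntry (i + 1) (k + 1)),
      Fin.sum_univ_eq_sum_range (fun i => leftSol t i * blockEntry (i + 1) (k + 1)),
      ← Finset.sum_range_succ]
    refine (Finset.sum_subset (Finset.range_mono hk) fun i _ hi => ?_).symm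
    rw [Finset.mem_range, not_lt] at hi
    rw [blockEntry_eq_zero (by omega), mul_zero]
  have h : leftSol t k * (t - blockEntry (k + 1) (k + 1)) =
      rowOneEntry (k + 1) + ∑ r : Fin k, leftSol t r * blockEntry (r + 1) (k + 1) := by
    conv_lhs => rw [leftSol]
    exact div_mul_cancel₀ _ (sub_blockEntry_self_pos ht k).ne'
  rw [hsum]
  linarith

theorem continuousOn_leftSol (k : ℕ) : ContinuousOn (fun t => leftSol t k) (Set.Ioi (1 / 2)) := by
  induction k using Nat.strong_induction_on with
  | _ k ih =>
    have h : (fun t => leftSol t k) = fun t =>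
        (rowOneEntry (k + 1) + ∑ r : Fin k, leftSol t r * blockEntry (r + 1) (k + 1)) /
          (t - blockEntry (k + 1) (k + 1)) := by
      funext t
      rw [leftSol]
    rw [h]
    refine ContinuousOn.div ?_ (by fun_prop) fun t ht => (sub_blockEntry_self_pos ht k).ne'
    refine continuousOn_const.add (continuousOn_finsetSum _ fun r _ => ?_)
    exact (ih r r.2).mul continuousOn_const

theorem abs_leftSol_le {t : ℝ} (ht : 1 / 2 < t) (k : ℕ) :
    |leftSol t k| ≤ 1 / 2 / (t - 1 / 2) := by
  have h := norm_mul_le_of_block_eq (n := k + 1) (s := fun i => (leftSol t i : ℂ))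
    (g := fun i => (rowOneEntry (i + 1) : ℂ)) (z := t) (fun i => by
      exact_mod_cast mul_leftSol ht i.2)
  have hg : ‖fun i : Fin (k + 1) => (rowOneEntry (i + 1) : ℂ)‖ ≤ 1 / 2 := by
    rw [pi_norm_le_iff_of_nonneg (by norm_num)]
    intro i
    rw [Complex.norm_real, Real.norm_eq_abs]
    exact abs_rowOneEntry_le i
  have hk := norm_le_pi_norm (fun i : Fin (k + 1) => (leftSol t i : ℂ)) (Fin.last k)
  rw [Complex.norm_real, Real.norm_eq_abs] at hk
  rw [Complex.norm_real, Real.norm_eq_abs, abs_of_pos (by linarith : 0 < t)] at h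
  rw [le_div_iff₀ (by linarith)]
  rw [Fin.val_last] at hk
  nlinarith [mul_le_mul_of_nonneg_left hk (by linarith : 0 ≤ t - 1 / 2)]

/-- The Schur complement of `t - B` in `t - truncA (n + 1)`, up to sign. -/
def schur (n : ℕ) (t : ℝ) : ℝ :=
  (t - 1 / 2) * (t - (1 / 2 + Real.log 2)) + constCoeff +
    ∑ i ∈ Finset.range n, leftSol t i * logCoeff i

theorem continuousOn_schur (n : ℕ) : ContinuousOn (schur n) (Set.Ioi (1 / 2)) := by
  unfold schur
  refine ContinuousOn.add (by fun_prop) (continuousOn_finsetSum _ fun i _ => ?_)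
  exact (continuousOn_leftSol i).mul continuousOn_const

/-- The part of `schur n` that does not depend on `n ≥ 4`. -/
def schurHead (t : ℝ) : ℝ :=
  (t - 1 / 2) * (t - (1 / 2 + Real.log 2)) + constCoeff +
    ∑ i ∈ Finset.range 4, leftSol t i * logCoeff i

theorem abs_schur_sub_head_le {t : ℝ} (ht : 1.23 ≤ t) {n : ℕ} (hn : 4 ≤ n) :
    |schur n t - schurHead t| ≤ 0.00026 := by
  obtain ⟨p, rfl⟩ := Nat.exists_eq_add_of_le hn
  -- The constant is `(1 / 2) / (1.23 - 1 / 2)`.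
  have hM : ∀ k, |leftSol t k| ≤ 50 / 73 := fun k => by
    refine (abs_leftSol_le (by norm_num at ht ⊢; linarith) k).trans ?_
    rw [div_le_div_iff₀ (by norm_num at ht ⊢; linarith) (by norm_num)]
    norm_num at ht ⊢
    linarith
  have e : schur (4 + p) t - schurHead t =
      ∑ i ∈ Finset.range p, leftSol t (i + 4) * logCoeff (i + 4) := by
    rw [schur, schurHead, Finset.sum_range_add]
    simp_rw [add_comm 4]
    ring
  rw [e]
  calc _ ≤ ∑ i ∈ Finset.range p, |leftSol t (i + 4) * logCoeff (i + 4)| :=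
        Finset.abs_sum_le_sum_abs _ _
    _ ≤ ∑ i ∈ Finset.range p, 50 / 73 * |logCoeff (i + 4)| := by
        refine Finset.sum_le_sum fun i _ => ?_
        rw [abs_mul]
        exact mul_le_mul_of_nonneg_right (hM _) (abs_nonneg _)
    _ ≤ 50 / 73 * (9 / (4 * (((4 : ℕ) : ℝ) + 1) ^ 2 * 3 ^ (4 + 1))) := by
        rw [← Finset.mul_sum]
        exact mul_le_mul_of_nonneg_left (sum_abs_logCoeff_le 4 p) (by norm_num)
    _ ≤ 0.00026 := by norm_num

theorem constCoeff_bounds : 0.02745 ≤ constCoeff ∧ constCoeff ≤ 0.0275 := by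
  have h1 := Real.pi_gt_d6
  have h2 := Real.pi_lt_d6
  have h3 := Real.log_two_gt_d9
  have h4 := Real.log_two_lt_d9
  have h5 := abs_le.1 dilogNegHalf_mem
  have h6 : (3.141592 : ℝ) ^ 2 ≤ Real.pi ^ 2 := by gcongr
  have h7 : Real.pi ^ 2 ≤ (3.141593 : ℝ) ^ 2 := by gcongr
  obtain ⟨h5, h5'⟩ := h5
  rw [constCoeff]
  norm_num at *
  constructor <;> linarith

/-- Peeling off the leading terms of each tail leaves `logTail 5` as the only transcendental
quantity. -/
theorem sum_logCoeff_four (w : ℕ → ℝ) :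
    ∑ i ∈ Finset.range 4, w i * logCoeff i =
      -w 0 * (1 / 3 + 1 / 18 + 1 / 81 + 1 / 324 + logTail 5) +
        w 1 / 2 * (1 / 18 + 1 / 81 + 1 / 324 + logTail 5) -
        w 2 / 3 * (1 / 81 + 1 / 324 + logTail 5) + w 3 / 4 * (1 / 324 + logTail 5) := by
  have h1 := logTail_eq_add 1 (by norm_num)
  have h2 := logTail_eq_add 2 (by norm_num)
  have h3 := logTail_eq_add 3 (by norm_num)
  have h4 := logTail_eq_add 4 (by norm_num)
  norm_num at h1 h2 h3 h4
  simp only [Finset.sum_range_succ, Finset.sum_range_zero, logCoeff]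
  norm_num [h1, h2, h3, h4]
  ring

theorem leftSol_zero (t : ℝ) : leftSol t 0 = 1 / 4 / (t + 1 / 4) := by
  rw [leftSol]
  norm_num [rowOneEntry, blockEntry]

theorem leftSol_one (t : ℝ) : leftSol t 1 = (1 / 2 - leftSol t 0 / 2) / t := by
  rw [leftSol]
  norm_num [rowOneEntry, blockEntry]
  ring

theorem leftSol_two (t : ℝ) :
    leftSol t 2 = (11 / 48 + leftSol t 0 / 16 - leftSol t 1 * (5 / 16)) / (t - 1 / 48) := by
  rw [leftSol]
  norm_num [rowOneEntry, blockEntry, Fin.sum_univ_succ, Nat.choose]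
  ring

theorem leftSol_three (t : ℝ) :
    leftSol t 3 = (17 / 64 - leftSol t 0 * (3 / 16) + leftSol t 1 * (3 / 32) -
      leftSol t 2 * (3 / 16)) / (t - 1 / 64) := by
  rw [leftSol]
  norm_num [rowOneEntry, blockEntry, Fin.sum_univ_succ, Nat.choose]
  ring

/-! ### Sign change of the Schur complement -/

theorem schurHead_left_lt : schurHead (1.232891 - 0.0007) < -0.0003 := by
  have h1 := logTail_five_bounds
  have h2 := constCoeff_bounds
  have h3 := Real.log_two_gt_d9
  -- At a rational point the values of `leftSol` are rational, so what remains is linear in `log 2`,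
  -- `constCoeff` and `logTail 5`.
  rw [schurHead, sum_logCoeff_four, leftSol_three, leftSol_two, leftSol_one, leftSol_zero]
  obtain ⟨h1, h1'⟩ := h1
  obtain ⟨h2, h2'⟩ := h2
  norm_num at *
  linarith

theorem lt_schurHead_right : 0.0003 < schurHead (1.232891 + 0.0007) := by
  have h1 := logTail_five_bounds
  have h2 := constCoeff_bounds
  have h3 := Real.log_two_lt_d9
  rw [schurHead, sum_logCoeff_four, leftSol_three, leftSol_two, leftSol_one, leftSol_zero]
  obtain ⟨h1, h1'⟩ := h1
  obtain ⟨h2, h2'⟩ := h2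
  norm_num at *
  linarith

/-- The margin 0.0003 at the endpoints exceeds the truncation error 0.00026, so the sign change is
the same for all `n ≥ 4`. -/
theorem exists_schur_eq_zero {n : ℕ} (hn : 4 ≤ n) :
    ∃ t ∈ Set.Icc (1.232891 - 0.0007 : ℝ) (1.232891 + 0.0007), schur n t = 0 := by
  have h1 := (abs_le.1 (abs_schur_sub_head_le (t := 1.232891 - 0.0007) (by norm_num) hn)).2
  have h2 := (abs_le.1 (abs_schur_sub_head_le (t := 1.232891 + 0.0007) (by norm_num) hn)).1
  have h3 := schurHead_left_lt
  have h4 := lt_schurHead_right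
  exact intermediate_value_Icc (by norm_num)
    ((continuousOn_schur n).mono fun t ht => lt_of_lt_of_le (by norm_num) ht.1)
    (show (0 : ℝ) ∈ Set.Icc _ _ from ⟨by linarith, by linarith⟩)

theorem hasEigenvalue_toLin'_transpose {K ι : Type*} [Field K] [Fintype ι] [DecidableEq ι]
    (M : Matrix ι ι K) (z : K) :
    Module.End.HasEigenvalue (Matrix.toLin' M.transpose) z ↔
      Module.End.HasEigenvalue (Matrix.toLin' M) z := by
  rw [Module.End.hasEigenvalue_iff_isRoot_charpoly, Module.End.hasEigenvalue_iff_isRoot_charpoly,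
    Matrix.charpoly_toLin', Matrix.charpoly_toLin', Matrix.charpoly_transpose]

theorem hasEigenvalue_of_schur_eq_zero {n : ℕ} {t : ℝ} (ht : 1 / 2 < t) (h : schur n t = 0) :
    Module.End.HasEigenvalue (Matrix.toLin' (truncA (n + 1))) t := by
  rw [← hasEigenvalue_toLin'_transpose]
  -- Entry 0 is dictated by column 1 and the tail by the block columns; column 0 then reads `schur n
  -- t = 0`.
  set v : Fin (n + 2) → ℝ :=
    Fin.cons (1 / 2 + Real.log 2 - t) (Fin.cons 1 fun i => leftSol t i) with hv
  have v0 : v 0 = 1 / 2 + Real.log 2 - t := rfl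
  have v1 : v 1 = 1 := rfl
  have vs : ∀ i : Fin n, v i.succ.succ = leftSol t i := fun _ => rfl
  refine Module.End.hasEigenvalue_of_hasEigenvector (x := v) ⟨?_, fun h0 => ?_⟩
  · rw [Module.End.mem_eigenspace_iff, Matrix.toLin'_apply, Matrix.mulVec_transpose]
    funext j
    rw [Pi.smul_apply, smul_eq_mul]
    refine Fin.cases ?_ (fun j => Fin.cases ?_ (fun k => ?_) j) j
    · rw [vecMul_truncA_zero]
      simp_rw [vs]
      rw [v0, v1, Fin.sum_univ_eq_sum_range (fun i => leftSol t i * logCoeff i)]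
      rw [schur] at h
      linarith
    · rw [Fin.succ_zero_eq_one, vecMul_truncA_one, v0, v1]
      ring
    · rw [vecMul_truncA_succ_succ]
      simp_rw [vs]
      rw [v1, one_mul, mul_leftSol ht k.2]
  · have := congrFun h0 1
    rw [v1] at this
    exact one_ne_zero this

end CarParking

end

noncomputable section

/-! ### A criterion for algebraic simplicity -/

/-- An eigenvalue is algebraically simple if some linear form `φ` vanishes on no eigenvector and
no eigenvector has a preimage under `f - μ` on which `φ` vanishes. -/
theorem Module.End.rootMultiplicity_charpoly_eq_one {K V : Type*} [Field K] [AddCommGroup V]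
    [Module K V] [FiniteDimensional K V] {f : Module.End K V} {μ : K} (φ : V →ₗ[K] K)
    (hf : f.HasEigenvalue μ) (hφ : ∀ x, f x = μ • x → φ x = 0 → x = 0)
    (hchain : ∀ x y, f x = μ • x → f y = μ • y + x → φ y = 0 → x = 0) :
    f.charpoly.rootMultiplicity μ = 1 := by
  rw [← LinearMap.finrank_maxGenEigenspace_eq]
  obtain ⟨e, he, he0⟩ := hf.exists_hasEigenvector
  rw [Module.End.mem_eigenspace_iff] at he
  have hφe : φ e ≠ 0 := fun h => he0 (hφ e he h)
  -- The kernels stabilise at exponent 1: a chain vector can be shifted by a multiple of `e` until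
  -- `φ` kills it, and then `hchain` applies.
  have hker : LinearMap.ker ((f - μ • 1) ^ 1) = LinearMap.ker ((f - μ • 1) ^ (Nat.succ 1)) := by
    refine le_antisymm (fun y hy => ?_) fun y hy => ?_
    · rw [LinearMap.mem_ker] at hy ⊢
      rw [pow_succ', Module.End.mul_apply, hy, map_zero]
    · rw [LinearMap.mem_ker, Nat.succ_eq_add_one, pow_succ, pow_one, Module.End.mul_apply] at hy
      rw [LinearMap.mem_ker, pow_one]
      refine hchain _ (y - (φ y / φ e) • e) ?_ ?_ ?_
      · rw [LinearMap.sub_apply, LinearMap.smul_apply, Module.End.one_apply, sub_eq_zero] at hy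
        exact hy
      · simp only [LinearMap.sub_apply, LinearMap.smul_apply, Module.End.one_apply, map_sub,
          map_smul, he, smul_sub, smul_comm μ]
        abel
      · rw [map_sub, map_smul, smul_eq_mul, div_mul_cancel₀ _ hφe, sub_self]
  have hmem : ∀ x ∈ f.maxGenEigenspace μ, f x = μ • x := by
    intro x hx
    rw [Module.End.mem_maxGenEigenspace] at hx
    obtain ⟨k, hk⟩ := hx
    have h1 : x ∈ LinearMap.ker ((f - μ • 1) ^ (1 + k)) := by
      rw [LinearMap.mem_ker, pow_add, Module.End.mul_apply, hk, map_zero]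
    rw [← Module.End.ker_pow_constant hker k, LinearMap.mem_ker, pow_one, LinearMap.sub_apply,
      LinearMap.smul_apply, Module.End.one_apply, sub_eq_zero] at h1
    exact h1
  refine le_antisymm ?_ ?_
  -- The generalised eigenspace now consists of eigenvectors and zero, so `φ` embeds it in the
  -- field.
  · have hinj : Function.Injective (φ ∘ₗ (f.maxGenEigenspace μ).subtype) := by
      rw [← LinearMap.ker_eq_bot, LinearMap.ker_eq_bot']
      intro x hx
      exact Subtype.ext (hφ x (hmem x x.2) hx)
    exact (LinearMap.finrank_le_finrank_of_injective hinj).trans_eq (Module.finrank_self K)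
  · rw [Submodule.one_le_finrank_iff]
    exact (Submodule.ne_bot_iff _).2
      ⟨e, Module.End.eigenspace_le_maxGenEigenspace (Module.End.mem_eigenspace_iff.2 he), he0⟩

namespace CarParking

/-! ### The other eigenvalues -/

open Matrix in
theorem eq_zero_of_vecMul_eq {n : ℕ} {z : ℂ} (hz : 1 / 2 < ‖z‖) {x : Fin (n + 2) → ℂ}
    (hx : x ᵥ* truncAC (n + 1) = z • x) (h1 : x 1 = 0) : x = 0 := by
  have hs : (fun i : Fin n => x i.succ.succ) = 0 := by
    have h := norm_mul_le_of_block_eq (s := fun i : Fin n => x i.succ.succ) (g := 0) (z := z)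
      (fun k => by
        have := congrFun hx k.succ.succ
        rw [vecMul_truncAC_succ_succ, h1, zero_mul] at this
        exact this.symm)
    rw [norm_zero] at h
    rw [← norm_le_zero_iff]
    by_contra hpos
    nlinarith
  have h0 : x 0 = 0 := by
    have := congrFun hx 1
    rw [vecMul_truncAC_one, Pi.smul_apply, h1] at this
    simpa using this
  funext j
  refine Fin.cases h0 (fun j => Fin.cases h1 (fun k => congrFun hs k) j) j

/-- The first coefficient carries most of the mass. It is kept apart because the first coordinate of
`s` will have a sharper bound than the sup norm. -/
theorem norm_sum_mul_logCoeff_le {p : ℕ} (s : Fin (p + 1) → ℂ) :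
    ‖∑ i, s i * (logCoeff i : ℂ)‖ ≤ ‖s 0‖ * (1 / 2) + ‖s‖ * (1 / 16) := by
  rw [Fin.sum_univ_succ]
  refine (norm_add_le _ _).trans (add_le_add ?_ ?_)
  · rw [norm_mul, Complex.norm_real, Real.norm_eq_abs]
    refine mul_le_mul_of_nonneg_left ((abs_logCoeff_le 0).trans ?_) (norm_nonneg _)
    norm_num
  · refine (norm_sum_le _ _).trans ?_
    have h := sum_abs_logCoeff_le 1 p
    norm_num at h
    refine le_trans ?_ (mul_le_mul_of_nonneg_left h (norm_nonneg s))
    rw [← Fin.sum_univ_eq_sum_range (fun i => |logCoeff (i + 1)|), Finset.mul_sum]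
    refine Finset.sum_le_sum fun i _ => ?_
    rw [norm_mul, Complex.norm_real, Real.norm_eq_abs]
    exact mul_le_mul_of_nonneg_right (norm_le_pi_norm s _) (abs_nonneg _)

theorem sum_mul_blockEntry_one {p : ℕ} (s : Fin (p + 1) → ℂ) :
    ∑ i, s i * (blockEntry (i + 1) 1 : ℂ) = -(s 0 * (1 / 4)) := by
  rw [Fin.sum_univ_succ, Finset.sum_eq_zero]
  · norm_num [blockEntry]
  · intro i _
    rw [blockEntry_eq_zero (by simp), Complex.ofReal_zero, mul_zero]

open Matrix in
-- The common core of uniqueness (`z ≠ lam`) and simplicity (`z = lam`). Assuming `‖z‖ ≥ 1.002`, the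
-- block equations bound the tail of `y`, and column 0 then makes `‖z‖` too small.
theorem norm_lt_of_chain {n : ℕ} (hn : 1 ≤ n) {lam : ℝ} (h₁ : 1.232 ≤ lam) (h₂ : lam ≤ 1.234)
    {z : ℂ} {x y : Fin (n + 2) → ℂ} (hx1 : x 1 = 1) (hy1 : y 1 = 0)
    (hx : x ᵥ* truncAC (n + 1) = (lam : ℂ) • x) (hy : y ᵥ* truncAC (n + 1) = z • y + x) :
    ‖z‖ < 1.002 := by
  by_contra! hz
  obtain ⟨p, rfl⟩ := Nat.exists_eq_add_of_le' hn
  norm_num at hz h₁ h₂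
  set s : Fin (p + 1) → ℂ := fun i => x i.succ.succ with hs
  set s' : Fin (p + 1) → ℂ := fun i => y i.succ.succ with hs'
  have ex : ∀ k : Fin (p + 1), (lam : ℂ) * s k =
      (rowOneEntry (k + 1) : ℂ) + ∑ i, s i * (blockEntry (i + 1) (k + 1) : ℂ) := fun k => by
    have := congrFun hx k.succ.succ
    rw [vecMul_truncAC_succ_succ, hx1, one_mul] at this
    exact this.symm
  have ey : ∀ k : Fin (p + 1), z * s' k =
      (-s) k + ∑ i, s' i * (blockEntry (i + 1) (k + 1) : ℂ) := fun k => by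
    have := congrFun hy k.succ.succ
    rw [vecMul_truncAC_succ_succ, hy1, zero_mul, zero_add, Pi.add_apply, Pi.smul_apply,
      smul_eq_mul] at this
    rw [this, Pi.neg_apply]
    ring
  have bs : (‖(lam : ℂ)‖ - 1 / 2) * ‖s‖ ≤ 1 / 2 := by
    refine (norm_mul_le_of_block_eq ex).trans ?_
    rw [pi_norm_le_iff_of_nonneg (by norm_num)]
    intro i
    rw [Complex.norm_real, Real.norm_eq_abs]
    exact abs_rowOneEntry_le i
  have bs' := norm_mul_le_of_block_eq ey
  have ex0 := ex 0
  have ey0 := ey 0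
  simp only [Fin.val_zero, zero_add, sum_mul_blockEntry_one, Pi.neg_apply] at ex0 ey0
  rw [show (rowOneEntry 1 : ℂ) = ((1 / 4 : ℝ) : ℂ) by norm_num [rowOneEntry]] at ex0
  -- The first column of the block has the single nonzero entry -1/4, so the first coordinates
  -- satisfy scalar equations.
  have bs0 : (lam + 1 / 4) * ‖s 0‖ = 1 / 4 := by
    have e : ((lam + 1 / 4 : ℝ) : ℂ) * s 0 = ((1 / 4 : ℝ) : ℂ) := by
      push_cast at ex0 ⊢
      linear_combination ex0
    have := congrArg norm e
    rwa [norm_mul, Complex.norm_real, Complex.norm_real, Real.norm_of_nonneg (by linarith),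
      Real.norm_of_nonneg (by norm_num)] at this
  have bs0' : (‖z‖ - 1 / 4) * ‖s' 0‖ ≤ ‖s 0‖ := by
    have e : z * s' 0 = -(s 0 + s' 0 * (1 / 4)) := by linear_combination ey0
    have := congrArg norm e
    rw [norm_mul, norm_neg] at this
    have h4 : ‖s' 0 * (1 / 4)‖ = ‖s' 0‖ * (1 / 4) := by rw [norm_mul]; norm_num
    linarith [norm_add_le (s 0) (s' 0 * (1 / 4))]
  have ey1 : y 0 = -1 := by
    have := congrFun hy 1
    rw [vecMul_truncAC_one, Pi.add_apply, Pi.smul_apply, hy1, hx1] at this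
    simp only [zero_mul, smul_zero, zero_add, add_zero] at this
    rw [← this, neg_neg]
  have ex1 : x 0 = (1 / 2 + Real.log 2 - lam : ℝ) := by
    have := congrFun hx 1
    rw [vecMul_truncAC_one, Pi.smul_apply, hx1] at this
    simp only [smul_eq_mul, mul_one, one_mul] at this
    push_cast at this ⊢
    linear_combination -this
  have ez : z = ((1 + Real.log 2 - lam : ℝ) : ℂ) - ∑ i, s' i * (logCoeff i : ℂ) := by
    have := congrFun hy 0
    rw [vecMul_truncAC_zero, Pi.add_apply, Pi.smul_apply, hy1, ey1, ex1, smul_eq_mul] at this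
    push_cast at this ⊢
    linear_combination this
  have bz : ‖z‖ ≤ 1 + Real.log 2 - lam + (‖s' 0‖ * (1 / 2) + ‖s'‖ * (1 / 16)) := by
    conv_lhs => rw [ez]
    refine (norm_sub_le _ _).trans (add_le_add ?_ (norm_sum_mul_logCoeff_le s'))
    rw [Complex.norm_real, Real.norm_of_nonneg]
    have := Real.log_two_gt_d9
    norm_num at this
    linarith
  rw [Complex.norm_real, Real.norm_of_nonneg (by linarith)] at bs
  rw [norm_neg] at bs'
  have l2 := Real.log_two_lt_d9
  norm_num at l2
  -- With `lam ≥ 1.232` and `‖z‖ ≥ 1.002`, these bounds turn `bz` into `‖z‖ < 0.75`, a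
  -- contradiction.
  have c1 : ‖s‖ ≤ 7 / 10 := by nlinarith [norm_nonneg s]
  have c2 : ‖s'‖ ≤ 7 / 5 := by nlinarith [norm_nonneg s']
  have c3 : ‖s 0‖ ≤ 1 / 5 := by nlinarith [norm_nonneg (s 0)]
  have c4 : ‖s' 0‖ ≤ 2 / 5 := by nlinarith [norm_nonneg (s' 0)]
  linarith

open Matrix in
theorem exists_left_eigenvector {n : ℕ} {z : ℂ} (hz : 1 / 2 < ‖z‖)
    (h : Module.End.HasEigenvalue (Matrix.toLin' (truncAC (n + 1))) z) :
    ∃ x : Fin (n + 2) → ℂ, x 1 = 1 ∧ x ᵥ* truncAC (n + 1) = z • x := by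
  rw [← hasEigenvalue_toLin'_transpose] at h
  obtain ⟨x, hx, hx0⟩ := h.exists_hasEigenvector
  rw [Module.End.mem_eigenspace_iff, Matrix.toLin'_apply, Matrix.mulVec_transpose] at hx
  have h1 : x 1 ≠ 0 := fun h1 => hx0 (eq_zero_of_vecMul_eq hz hx h1)
  refine ⟨(x 1)⁻¹ • x, ?_, ?_⟩
  · rw [Pi.smul_apply, smul_eq_mul, inv_mul_cancel₀ h1]
  · rw [Matrix.smul_vecMul, hx, smul_comm]

theorem charpoly_truncAC (m : ℕ) :
    (truncAC m).charpoly = (truncA m).charpoly.map Complex.ofRealHom :=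
  Matrix.charpoly_map (truncA m) Complex.ofRealHom

theorem hasEigenvalue_truncAC {m : ℕ} {t : ℝ}
    (h : Module.End.HasEigenvalue (Matrix.toLin' (truncA m)) t) :
    Module.End.HasEigenvalue (Matrix.toLin' (truncAC m)) (t : ℂ) := by
  rw [Module.End.hasEigenvalue_iff_isRoot_charpoly, Matrix.charpoly_toLin'] at h ⊢
  rw [charpoly_truncAC]
  exact h.map (f := Complex.ofRealHom)

theorem norm_lt_of_hasEigenvalue {n : ℕ} (hn : 1 ≤ n) {lam : ℝ} (h₁ : 1.232 ≤ lam)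
    (h₂ : lam ≤ 1.234)
    (hlam : Module.End.HasEigenvalue (Matrix.toLin' (truncAC (n + 1))) (lam : ℂ)) {z : ℂ}
    (hz : Module.End.HasEigenvalue (Matrix.toLin' (truncAC (n + 1))) z) (hne : z ≠ lam) :
    ‖z‖ < 1.002 := by
  by_contra! hlt
  obtain ⟨x, hx1, hx⟩ := exists_left_eigenvector (by
    rw [Complex.norm_real, Real.norm_eq_abs]
    norm_num at h₁ ⊢
    exact lt_of_lt_of_le (by linarith) (le_abs_self lam)) hlam
  obtain ⟨u, hu1, hu⟩ := exists_left_eigenvector (by norm_num at hlt ⊢; linarith) hz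
  have hd : z - lam ≠ 0 := sub_ne_zero.2 hne
  -- The chain equation holds because `(u - x) A = z (u - x) + (z - lam) x`.
  refine hlt.not_gt (norm_lt_of_chain hn h₁ h₂ (y := (z - lam)⁻¹ • (u - x)) hx1 ?_ hx ?_)
  · rw [Pi.smul_apply, Pi.sub_apply, hx1, hu1, sub_self, smul_zero]
  · rw [Matrix.smul_vecMul, Matrix.sub_vecMul, hx, hu]
    funext j
    simp only [Pi.smul_apply, Pi.sub_apply, Pi.add_apply, smul_eq_mul]
    field_simp
    ring

theorem rootMultiplicity_eq_one {n : ℕ} (hn : 1 ≤ n) {lam : ℝ} (h₁ : 1.232 ≤ lam)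
    (h₂ : lam ≤ 1.234)
    (hlam : Module.End.HasEigenvalue (Matrix.toLin' (truncAC (n + 1))) (lam : ℂ)) :
    (truncAC (n + 1)).charpoly.rootMultiplicity (lam : ℂ) = 1 := by
  have hnorm : ‖(lam : ℂ)‖ = lam := by
    rw [Complex.norm_real, Real.norm_of_nonneg]
    norm_num at h₁
    linarith
  have hhalf : 1 / 2 < ‖(lam : ℂ)‖ := by
    rw [hnorm]
    norm_num at h₁ ⊢
    linarith
  rw [← Matrix.charpoly_transpose, ← Matrix.charpoly_toLin']
  refine Module.End.rootMultiplicity_charpoly_eq_one (LinearMap.proj 1)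
    ((hasEigenvalue_toLin'_transpose _ _).2 hlam) (fun x hx h1 => ?_) fun x y hx hy h1 => ?_
  · rw [Matrix.toLin'_apply, Matrix.mulVec_transpose] at hx
    exact eq_zero_of_vecMul_eq hhalf hx h1
  · rw [Matrix.toLin'_apply, Matrix.mulVec_transpose] at hx hy
    by_contra hx0
    have hx1 : x 1 ≠ 0 := fun h => hx0 (eq_zero_of_vecMul_eq hhalf hx h)
    -- A Jordan chain at `lam` would give `lam < 1.002`.
    have h := norm_lt_of_chain hn h₁ h₂ (x := (x 1)⁻¹ • x) (y := (x 1)⁻¹ • y) (z := lam)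
      (by rw [Pi.smul_apply, smul_eq_mul, inv_mul_cancel₀ hx1])
      (by rw [Pi.smul_apply, show y 1 = 0 from h1, smul_zero])
      (by rw [Matrix.smul_vecMul, hx, smul_comm])
      (by rw [Matrix.smul_vecMul, hy, smul_add, smul_comm])
    rw [hnorm] at h
    norm_num at h h₁
    linarith

end CarParking

end

theorem mainTheorem5 (m : ℕ) (hm : 7 ≤ m) :
    ∃ lam : ℝ,
      lam ∈ Set.Icc (1.232891 - 0.0007 : ℝ) (1.232891 + 0.0007) ∧
      Module.End.HasEigenvalue (Matrix.toLin' (CarParking.truncA m)) lam ∧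
      (∀ x ∈ Set.Icc (1.232891 - 0.0007 : ℝ) (1.232891 + 0.0007),
        Module.End.HasEigenvalue (Matrix.toLin' (CarParking.truncA m)) x → x = lam) ∧
      (CarParking.truncAC m).charpoly.rootMultiplicity (lam : ℂ) = 1 ∧
      ∀ z : ℂ, Module.End.HasEigenvalue (Matrix.toLin' (CarParking.truncAC m)) z →
        z ≠ (lam : ℂ) → ‖z‖ < 1.002 := by
  obtain ⟨n, rfl⟩ := Nat.exists_eq_add_of_le' (show 1 ≤ m by omega)
  have hn : 1 ≤ n := by omega
  obtain ⟨lam, hI, h0⟩ := CarParking.exists_schur_eq_zero (n := n) (by omega)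
  have h₁ : 1.232 ≤ lam := le_trans (by norm_num) hI.1
  have h₂ : lam ≤ 1.234 := hI.2.trans (by norm_num)
  have hev := CarParking.hasEigenvalue_of_schur_eq_zero
    (lt_of_lt_of_le (by norm_num) h₁) h0
  have hevC := CarParking.hasEigenvalue_truncAC hev
  refine ⟨lam, hI, hev, fun x hx hxe => ?_, CarParking.rootMultiplicity_eq_one hn h₁ h₂ hevC,
    fun z hz hne => CarParking.norm_lt_of_hasEigenvalue hn h₁ h₂ hevC hz hne⟩
  by_contra hne
  have h := CarParking.norm_lt_of_hasEigenvalue hn h₁ h₂ hevC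
    (CarParking.hasEigenvalue_truncAC hxe) (by exact_mod_cast hne)
  rw [Complex.norm_real, Real.norm_eq_abs] at h
  have h3 := (le_abs_self x).trans_lt h
  have h4 := hx.1
  norm_num at h3 h4
  linarith
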